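/- Let $n$ be a dimension. For a measurable function $g$ on $\mathbb{R}^n$ with values in $\mathbb{C}$ or $[0,\infty]$, let $$Mg(x)=\sup_{Q\ni x}\frac1{|Q|}\int_Q|g(y)|\,dy$$ be the Hardy--Littlewood maximal function, where the supremum is over all cubes $Q$ with sides parallel to the axes that contain $x$. Put $M^2=M\circ M$ and $M_rg=(M(|g|^r))^{1/r}$. For a weight $v:\mathbb{R}^n\to[0,\infty]$ write $\|g\|_{L^p(v)}=\left(\int_{\mathbb{R}^n}|g|^p\,v\,dx\right)^{1/p}\in[0,\infty]$, and for $1<s<\infty$ let $s'=\frac{s}{s-1}$. There is a constant $c>0$, depending only on $n$ (in particular independent of $p$, $r$, $w$ and $f$), such that for all $1<p,r<\infty$, every measurable $w:\mathbb{R}^n\to[0,\infty)$ and every measurable $f:\mathbb{R}^n\to\mathbb{C}$, the function $M^2f$ is measurable and $$\|M^2f\|_{L^p((M_rw)^{1-p})}\le c\,(p')^2\,(r')^{1+1/p}\,\|f\|_{L^p(w^{1-p})}.$$ Here $0^{1-p}=\infty$, $\infty^{1-p}=0$ and $0\cdot\infty=0$. In particular, $M^2$ maps $L^p(w^{1-p})$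 into $L^p((M_rw)^{1-p})$. -/

import Mathlib

open MeasureTheory
open scoped ENNReal NNReal

noncomputable section

/-- The open cube in `ℝⁿ` with sides parallel to the axes, lower corner `a` and side length `ℓ`. -/
def cube {n : ℕ} (a : EuclideanSpace ℝ (Fin n)) (ℓ : ℝ) : Set (EuclideanSpace ℝ (Fin n)) :=
  {y | ∀ i, y i ∈ Set.Ioo (a i) (a i + ℓ)}

/-- The (uncentred) Hardy–Littlewood maximal function `Mg(x) = sup_{Q ∋ x} |Q|⁻¹ ∫_Q |g|`, where `Q`
runs over all cubes of positive side length containing `x`. Its values lie in `[0, ∞]`. The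
argument `g` may be complex valued or `[0, ∞]`-valued, so that `M` can be iterated. -/
def hlMaximal {n : ℕ} {ε : Type*} [ENorm ε] (g : EuclideanSpace ℝ (Fin n) → ε)
    (x : EuclideanSpace ℝ (Fin n)) : ℝ≥0∞ :=
  ⨆ (a : EuclideanSpace ℝ (Fin n)) (ℓ : ℝ) (_ : 0 < ℓ) (_ : x ∈ cube a ℓ),
    (volume (cube a ℓ))⁻¹ * ∫⁻ y in cube a ℓ, ‖g y‖ₑ

/-- `M_r g = (M(|g|^r))^{1/r}`. -/
def hlMaximalPow {n : ℕ} {ε : Type*} [ENorm ε] (r : ℝ) (g : EuclideanSpace ℝ (Fin n) → ε)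
    (x : EuclideanSpace ℝ (Fin n)) : ℝ≥0∞ :=
  (hlMaximal (fun y => ‖g y‖ₑ ^ r) x) ^ (1 / r)

/-- The norm of `L^p(v)`, that is `(∫ |g|^p v dx)^{1/p}`, for a weight `v` with values in `[0, ∞]`. -/
def weightedLpNorm {n : ℕ} {ε : Type*} [ENorm ε] (p : ℝ) (v : EuclideanSpace ℝ (Fin n) → ℝ≥0∞)
    (g : EuclideanSpace ℝ (Fin n) → ε) : ℝ≥0∞ :=
  eLpNorm g (ENNReal.ofReal p) (volume.withDensity v)

end

/-! The two-weight bound for a single `M` is proved first, with the `p`-th power of its constant of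
order `C ^ p * p' * r'`. Hölder on each cube with exponents `a = p' * r` and `a'` gives `Mg ≤ M((g *
w^(-1/p'))^a')^(1/a') * (M_r w)^(1/p')`. Raised to the power `p`, the weight factor cancels `(M_r
w)^(1-p)`, and what remains is the unweighted bound in `L^q`, `q = p / a' > 1`, whose constant
involves `q / (q - 1) ≤ p' * r'` (`lintegral_hlMaximal_rpow_mul_hlMaximalPow_le`).

For `M²`, apply this bound to `f` with the weight `w`, and to `Mf` with the weight `M_r w` and the
exponent `s = (1 + r) / 2`. The second application produces `M_s (M_r w)`, which Coifman–Rochberg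
bounds by a multiple of `r' * M_r w` (`hlMaximalPow_hlMaximalPow_le`). The powers of `r'` are `p -
1` from this comparison and one from each application, so `r' ^ (p + 1)` in total; the `p`-th root
is `r' ^ (1 + 1/p)`. -/

/-! ### Cubes and their volumes. -/

theorem isOpen_cube {n : ℕ} (a : EuclideanSpace ℝ (Fin n)) (ℓ : ℝ) : IsOpen (cube a ℓ) := by
  have : cube a ℓ = ⋂ i, (fun y : EuclideanSpace ℝ (Fin n) => y i) ⁻¹' Set.Ioo (a i) (a i + ℓ) := by
    ext y; simp [cube]
  rw [this]
  exact isOpen_iInter_of_finite fun i => isOpen_Ioo.preimage (by fun_prop)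

theorem volume_cube {n : ℕ} (a : EuclideanSpace ℝ (Fin n)) (ℓ : ℝ) :
    volume (cube a ℓ) = ENNReal.ofReal ℓ ^ n := by
  have h := (EuclideanSpace.volume_preserving_symm_measurableEquiv_toLp (Fin n)).measure_preimage
    (s := Set.univ.pi fun i => Set.Ioo (a i) (a i + ℓ))
    (MeasurableSet.univ_pi fun i => measurableSet_Ioo).nullMeasurableSet
  have e : cube a ℓ = (MeasurableEquiv.toLp 2 (Fin n → ℝ)).symm ⁻¹'
      (Set.univ.pi fun i => Set.Ioo (a i) (a i + ℓ)) := by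
    ext y; simp [cube]
  rw [e, h, volume_pi_pi]
  simp

theorem volume_cube_pos {n : ℕ} (a : EuclideanSpace ℝ (Fin n)) {ℓ : ℝ} (h : 0 < ℓ) :
    volume (cube a ℓ) ≠ 0 := by
  rw [volume_cube]; exact pow_ne_zero _ (by simpa using h)

theorem volume_cube_ne_top {n : ℕ} (a : EuclideanSpace ℝ (Fin n)) (ℓ : ℝ) :
    volume (cube a ℓ) ≠ ∞ := by
  rw [volume_cube]; exact ENNReal.pow_ne_top ENNReal.ofReal_ne_top

/-! ### Basic properties of `M` and the weak type bound. -/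

section
variable {n : ℕ} {ε : Type*} [ENorm ε]

theorem le_hlMaximal (g : EuclideanSpace ℝ (Fin n) → ε) {x a : EuclideanSpace ℝ (Fin n)} {ℓ : ℝ}
    (hℓ : 0 < ℓ) (hx : x ∈ cube a ℓ) :
    (volume (cube a ℓ))⁻¹ * ∫⁻ y in cube a ℓ, ‖g y‖ₑ ≤ hlMaximal g x := by
  unfold hlMaximal
  exact le_iSup_of_le a <| le_iSup_of_le ℓ <| le_iSup_of_le hℓ <| le_iSup_of_le hx le_rfl

theorem setLIntegral_cube_le (g : EuclideanSpace ℝ (Fin n) → ε) {x a : EuclideanSpace ℝ (Fin n)}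
    {ℓ : ℝ} (hℓ : 0 < ℓ) (hx : x ∈ cube a ℓ) :
    ∫⁻ y in cube a ℓ, ‖g y‖ₑ ≤ volume (cube a ℓ) * hlMaximal g x := by
  have := le_hlMaximal g hℓ hx
  rwa [ENNReal.inv_mul_le_iff (volume_cube_pos a hℓ) (volume_cube_ne_top a ℓ)] at this

theorem hlMaximal_le (g : EuclideanSpace ℝ (Fin n) → ε) {x : EuclideanSpace ℝ (Fin n)} {t : ℝ≥0∞}
    (h : ∀ a ℓ, 0 < ℓ → x ∈ cube a ℓ →
      ∫⁻ y in cube a ℓ, ‖g y‖ₑ ≤ volume (cube a ℓ) * t) :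
    hlMaximal g x ≤ t := by
  unfold hlMaximal
  refine iSup_le fun a => iSup_le fun ℓ => iSup_le fun hℓ => iSup_le fun hx => ?_
  rw [ENNReal.inv_mul_le_iff (volume_cube_pos a hℓ) (volume_cube_ne_top a ℓ)]
  exact h a ℓ hℓ hx

theorem exists_cube_of_lt_hlMaximal (g : EuclideanSpace ℝ (Fin n) → ε)
    {x : EuclideanSpace ℝ (Fin n)} {t : ℝ≥0∞} (h : t < hlMaximal g x) :
    ∃ a ℓ, 0 < ℓ ∧ x ∈ cube a ℓ ∧ t * volume (cube a ℓ) < ∫⁻ y in cube a ℓ, ‖g y‖ₑ := by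
  by_contra! H
  refine absurd (hlMaximal_le g fun a ℓ hℓ hx => ?_) (not_le.2 h)
  rw [mul_comm]; exact H a ℓ hℓ hx

theorem lowerSemicontinuous_hlMaximal (g : EuclideanSpace ℝ (Fin n) → ε) :
    LowerSemicontinuous (hlMaximal g) := by
  intro x t ht
  obtain ⟨a, ℓ, hℓ, hx, h⟩ := exists_cube_of_lt_hlMaximal g ht
  filter_upwards [(isOpen_cube a ℓ).mem_nhds hx] with y hy
  by_contra! H
  refine absurd h (not_lt.2 ((setLIntegral_cube_le g hℓ hy).trans ?_))
  rw [mul_comm]; gcongr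

theorem measurable_hlMaximal (g : EuclideanSpace ℝ (Fin n) → ε) : Measurable (hlMaximal g) :=
  (lowerSemicontinuous_hlMaximal g).measurable

theorem hlMaximal_enorm (g : EuclideanSpace ℝ (Fin n) → ε) :
    hlMaximal (fun y => ‖g y‖ₑ) = hlMaximal g := by
  ext x; simp [hlMaximal]

theorem hlMaximal_congr_ae {g h : EuclideanSpace ℝ (Fin n) → ε}
    (e : g =ᵐ[volume] h) : hlMaximal g = hlMaximal h := by
  ext x
  unfold hlMaximal
  have (s : Set (EuclideanSpace ℝ (Fin n))) : ∫⁻ y in s, ‖g y‖ₑ = ∫⁻ y in s, ‖h y‖ₑ :=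
    lintegral_congr_ae (ae_restrict_of_ae (e.mono fun y hy => by simp only [hy]))
  simp only [this]

/-- The weak type `(1, 1)` bound for the maximal function. -/
theorem mul_volume_lt_hlMaximal_le (g : EuclideanSpace ℝ (Fin n) → ε) (t : ℝ≥0∞) :
    t * volume {x | t < hlMaximal g x} ≤ 5 ^ n * ∫⁻ y, ‖g y‖ₑ := by
  have ho : IsOpen {x | t < hlMaximal g x} := (lowerSemicontinuous_hlMaximal g).isOpen_preimage t
  rw [ho.measure_eq_iSup_isCompact]
  simp only [ENNReal.mul_iSup]
  refine iSup_le fun K => iSup_le fun hK => iSup_le fun hKc => ?_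
  choose! a ℓ hℓ hx h using fun x (hx : x ∈ K) => exists_cube_of_lt_hlMaximal g (hK hx)
  obtain ⟨s, hsK, hs⟩ := hKc.elim_nhds_subcover (fun x => cube (a x) (ℓ x))
    fun x hxK => (isOpen_cube _ _).mem_nhds (hx x hxK)
  obtain ⟨R, hR⟩ : ∃ R, ∀ x ∈ (s : Set _), ℓ x ≤ R := by
    obtain ⟨R, hR⟩ := (s.finite_toSet.image ℓ).bddAbove
    exact ⟨R, fun x hx => hR ⟨x, hx, rfl⟩⟩
  -- With ratio `2`, a cube meeting a selected cube of side `ℓ` sticks out by at most `2ℓ` on either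
  -- side, so enlarging to side `5ℓ` covers it; hence `5 ^ n`.
  obtain ⟨u, hus, hu, hcov⟩ := Vitali.exists_disjoint_subfamily_covering_enlargement
    (fun x => cube (a x) (ℓ x)) s ℓ 2 (by norm_num) (fun x hxs => (hℓ x (hsK x hxs)).le) R hR
    (fun x hxs => ⟨x, hx x (hsK x hxs)⟩)
  have huf : u.Finite := s.finite_toSet.subset hus
  have hsub : K ⊆ ⋃ x ∈ u, cube (WithLp.toLp 2 fun i => a x i - 2 * ℓ x) (5 * ℓ x) := by
    intro y hy
    obtain ⟨z, hz, hyz⟩ := Set.mem_iUnion₂.1 (hs hy)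
    obtain ⟨b, hb, ⟨v, hv1, hv2⟩, hzb⟩ := hcov z hz
    refine Set.mem_iUnion₂.2 ⟨b, hb, fun i => ?_⟩
    have h1 := hyz i
    have h2 := hv1 i
    have h3 := hv2 i
    simp only [Set.mem_Ioo] at h1 h2 h3 ⊢
    constructor <;> linarith
  have hvol : ∀ x : EuclideanSpace ℝ (Fin n),
      volume (cube (WithLp.toLp 2 fun i => a x i - 2 * ℓ x) (5 * ℓ x))
      = 5 ^ n * volume (cube (a x) (ℓ x)) := by
    intro x
    rw [volume_cube, volume_cube, ENNReal.ofReal_mul (by norm_num), mul_pow]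
    norm_num
  have : Countable u := huf.countable.to_subtype
  calc t * volume K ≤ t * ∑' x : u, 5 ^ n * volume (cube (a x) (ℓ x)) := by
        gcongr
        refine (measure_mono hsub).trans ((measure_biUnion_le _ huf.countable _).trans ?_)
        simp only [hvol, le_refl]
    _ = 5 ^ n * ∑' x : u, t * volume (cube (a x) (ℓ x)) := by
        rw [ENNReal.tsum_mul_left, ENNReal.tsum_mul_left]; ring
    _ ≤ 5 ^ n * ∑' x : u, ∫⁻ y in cube (a x) (ℓ x), ‖g y‖ₑ := by
        gcongr with x
        exact (h x (hsK x (hus x.2))).le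
    _ = 5 ^ n * ∫⁻ y in ⋃ x ∈ u, cube (a x) (ℓ x), ‖g y‖ₑ := by
        rw [lintegral_biUnion huf.countable (fun x _ => (isOpen_cube _ _).measurableSet) hu]
    _ ≤ _ := by gcongr; exact Measure.restrict_le_self
end

/-! ### Layer cake formula and Kolmogorov's inequality. -/

theorem lintegral_Ioc_mul_rpow {q : ℝ} (hq : 0 < q) {T : ℝ} (hT : 0 ≤ T) :
    ∫⁻ s in Set.Ioc 0 T, ENNReal.ofReal (q * s ^ (q - 1)) = ENNReal.ofReal (T ^ q) := by
  have hi : IntervalIntegrable (fun s : ℝ => q * s ^ (q - 1)) volume 0 T :=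
    (intervalIntegral.intervalIntegrable_rpow' (by linarith)).const_mul q
  rw [← ofReal_integral_eq_lintegral_ofReal]
  · rw [← intervalIntegral.integral_of_le hT, intervalIntegral.integral_const_mul,
      integral_rpow (Or.inl (by linarith)), sub_add_cancel, Real.zero_rpow hq.ne']
    congr 1; field_simp; ring
  · exact (intervalIntegrable_iff_integrableOn_Ioc_of_le hT).1 hi
  · filter_upwards [ae_restrict_mem measurableSet_Ioc] with s hs
    exact mul_nonneg hq.le (Real.rpow_nonneg hs.1.le _)

theorem lintegral_Ioi_mul_rpow {δ : ℝ} (h0 : 0 ≤ δ) (h1 : δ < 1) {T : ℝ} (hT : 0 < T) :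
    ∫⁻ s in Set.Ioi T, ENNReal.ofReal (δ * s ^ (δ - 2)) =
      ENNReal.ofReal (δ / (1 - δ) * T ^ (δ - 1)) := by
  rw [← ofReal_integral_eq_lintegral_ofReal]
  · rw [integral_const_mul, integral_Ioi_rpow_of_lt (by linarith) hT]
    congr 1
    have : 1 - δ ≠ 0 := by linarith
    rw [show δ - 2 + 1 = -(1 - δ) by ring, show δ - 1 = -(1 - δ) by ring]
    field_simp
  · exact (integrableOn_Ioi_rpow_of_lt (by linarith) hT).const_mul δ
  · filter_upwards [ae_restrict_mem measurableSet_Ioi] with s hs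
    exact mul_nonneg h0 (Real.rpow_nonneg (hT.trans hs).le _)

theorem lintegral_indicator_ofReal_lt_mul_rpow {q : ℝ} (hq : 0 < q) (t : ℝ≥0∞) :
    ∫⁻ s in Set.Ioi (0 : ℝ), {s : ℝ | ENNReal.ofReal s < t}.indicator
      (fun s => ENNReal.ofReal (q * s ^ (q - 1))) s = t ^ q := by
  have hm (t : ℝ≥0∞) : MeasurableSet {s : ℝ | ENNReal.ofReal s < t} :=
    measurableSet_lt ENNReal.measurable_ofReal measurable_const
  have key (T : ℝ) (hT : 0 ≤ T) :
      ∫⁻ s in Set.Ioi (0 : ℝ), {s : ℝ | ENNReal.ofReal s < ENNReal.ofReal T}.indicator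
      (fun s => ENNReal.ofReal (q * s ^ (q - 1))) s = ENNReal.ofReal T ^ q := by
    rw [ENNReal.ofReal_rpow_of_nonneg hT hq.le, ← lintegral_Ioc_mul_rpow hq hT,
      ← restrict_Ioo_eq_restrict_Ioc, lintegral_indicator (hm _), Measure.restrict_restrict (hm _)]
    congr 2
    ext s
    simp only [Set.mem_inter_iff, Set.mem_ofPred_eq, Set.mem_Ioi, Set.mem_Ioo]
    constructor
    · rintro ⟨h1, h2⟩
      exact ⟨h2, (ENNReal.ofReal_lt_ofReal_iff_of_nonneg h2.le).1 h1⟩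
    · rintro ⟨h1, h2⟩
      exact ⟨(ENNReal.ofReal_lt_ofReal_iff_of_nonneg h1.le).2 h2, h1⟩
  rcases eq_or_ne t ∞ with rfl | ht
  · rw [ENNReal.top_rpow_of_pos hq]
    -- Truncating at height `R ^ (1/q)` already gives the value `R`.
    refine ENNReal.eq_top_of_forall_nnreal_le fun R => ?_
    have hR := key ((R : ℝ) ^ q⁻¹) (by positivity)
    rw [ENNReal.ofReal_rpow_of_nonneg (by positivity) hq.le, Real.rpow_inv_rpow R.coe_nonneg hq.ne',
      ENNReal.ofReal_coe_nnreal] at hR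
    rw [← hR]
    exact lintegral_mono fun s => Set.indicator_le_indicator_of_subset
      (fun x hx => hx.trans ENNReal.ofReal_lt_top) (fun _ => zero_le) s
  · rw [← ENNReal.ofReal_toReal ht]
    exact key _ ENNReal.toReal_nonneg

theorem measurable_indicator_ofReal_lt {α : Type*} [MeasurableSpace α] {s : α → ℝ}
    {F : α → ℝ≥0∞} (hs : Measurable s) (hF : Measurable F) {φ : ℝ → ℝ≥0∞} (hφ : Measurable φ) :
    Measurable fun x => {s : ℝ | ENNReal.ofReal s < F x}.indicator φ (s x) :=
  Measurable.ite (measurableSet_lt hs.ennreal_ofReal hF) (hφ.comp hs) measurable_const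

/-- The layer cake formula for `[0, ∞]`-valued functions. -/
theorem lintegral_rpow_eq_lintegral_measure_lt {α : Type*} [MeasurableSpace α] (μ : Measure α)
    [SFinite μ] {F : α → ℝ≥0∞} (hF : Measurable F) {q : ℝ} (hq : 0 < q) :
    ∫⁻ x, F x ^ q ∂μ = ∫⁻ s in Set.Ioi (0 : ℝ),
      ENNReal.ofReal (q * s ^ (q - 1)) * μ {x | ENNReal.ofReal s < F x} := by
  simp_rw [← lintegral_indicator_ofReal_lt_mul_rpow hq]
  rw [lintegral_lintegral_swap]
  · refine lintegral_congr fun s => ?_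
    have : ∀ x, {s : ℝ | ENNReal.ofReal s < F x}.indicator
        (fun s => ENNReal.ofReal (q * s ^ (q - 1))) s =
        {x | ENNReal.ofReal s < F x}.indicator
          (fun _ => ENNReal.ofReal (q * s ^ (q - 1))) x := fun x => by
      simp [Set.indicator]
    simp_rw [this]
    rw [lintegral_indicator_const (measurableSet_lt measurable_const hF)]
  · exact (measurable_indicator_ofReal_lt measurable_snd (hF.comp measurable_fst)
      (φ := fun s => ENNReal.ofReal (q * s ^ (q - 1))) (by fun_prop)).aemeasurable

/-- Kolmogorov's inequality: a function in weak `L¹` of a finite measure lies in `L^δ`, `δ < 1`. -/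
theorem lintegral_rpow_le_of_weak_type {α : Type*} [MeasurableSpace α] (μ : Measure α)
    [SFinite μ] {F : α → ℝ≥0∞} (hF : Measurable F) {δ T : ℝ} (h0 : 0 < δ) (h1 : δ < 1)
    (hT : 0 < T) (hw : ∀ s : ℝ, 0 < s →
      ENNReal.ofReal s * μ {x | ENNReal.ofReal s < F x} ≤ μ Set.univ * ENNReal.ofReal T) :
    ∫⁻ x, F x ^ δ ∂μ ≤ μ Set.univ * ENNReal.ofReal (T ^ δ / (1 - δ)) := by
  -- Below `T` the level sets are bounded by the total mass, above `T` by the weak type hypothesis;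
  -- the two pieces add up through `1 + δ / (1 - δ) = 1 / (1 - δ)`.
  rw [lintegral_rpow_eq_lintegral_measure_lt μ hF h0, ← Set.Ioc_union_Ioi_eq_Ioi hT.le]
  refine (lintegral_union_le _ _ _).trans ?_
  have h1' : 0 < 1 - δ := by linarith
  have A : ∫⁻ s in Set.Ioc 0 T, ENNReal.ofReal (δ * s ^ (δ - 1)) * μ {x | ENNReal.ofReal s < F x}
      ≤ μ Set.univ * ENNReal.ofReal (T ^ δ) := by
    rw [← lintegral_Ioc_mul_rpow h0 hT.le, mul_comm (μ Set.univ),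
      ← lintegral_mul_const _ (by fun_prop)]
    gcongr
    exact Set.subset_univ _
  have B : ∫⁻ s in Set.Ioi T, ENNReal.ofReal (δ * s ^ (δ - 1)) * μ {x | ENNReal.ofReal s < F x}
      ≤ μ Set.univ * ENNReal.ofReal (δ / (1 - δ) * T ^ δ) := by
    have e : ENNReal.ofReal (δ / (1 - δ) * T ^ δ) =
        ENNReal.ofReal (δ / (1 - δ) * T ^ (δ - 1)) * ENNReal.ofReal T := by
      rw [← ENNReal.ofReal_mul (by positivity), mul_assoc, ← Real.rpow_add_one hT.ne',
        sub_add_cancel]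
    rw [e, ← lintegral_Ioi_mul_rpow h0.le h1 hT, mul_left_comm,
      ← lintegral_mul_const _ (by fun_prop)]
    refine setLIntegral_mono (by fun_prop) fun s hs => ?_
    have hs0 : 0 < s := hT.trans hs
    calc ENNReal.ofReal (δ * s ^ (δ - 1)) * μ {x | ENNReal.ofReal s < F x}
        = ENNReal.ofReal (δ * s ^ (δ - 2)) *
          (ENNReal.ofReal s * μ {x | ENNReal.ofReal s < F x}) := by
          rw [← mul_assoc, ← ENNReal.ofReal_mul (by positivity), mul_assoc,
            ← Real.rpow_add_one hs0.ne', show δ - 2 + 1 = δ - 1 by ring]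
      _ ≤ _ := mul_le_mul_right (hw s hs0) _
  refine (add_le_add A B).trans ?_
  rw [← mul_add, ← ENNReal.ofReal_add (by positivity) (by positivity)]
  gcongr
  apply le_of_eq
  field_simp
  ring

/-! ### Strong type bound and the Coifman–Rochberg estimate. -/

section
variable {n : ℕ}

theorem hlMaximal_le_indicator_add (g : EuclideanSpace ℝ (Fin n) → ℝ≥0∞) (t : ℝ≥0∞)
    (x : EuclideanSpace ℝ (Fin n)) :
    hlMaximal g x ≤ hlMaximal ({y | t < g y}.indicator g) x + t := by
  refine hlMaximal_le g fun a ℓ hℓ hx => ?_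
  rw [mul_add]
  calc ∫⁻ y in cube a ℓ, ‖g y‖ₑ ≤ ∫⁻ y in cube a ℓ, ‖{y | t < g y}.indicator g y‖ₑ + t := by
        refine lintegral_mono fun y => ?_
        by_cases h : t < g y <;> simp [h, not_lt.1]
    _ = (∫⁻ y in cube a ℓ, ‖{y | t < g y}.indicator g y‖ₑ) + volume (cube a ℓ) * t := by
        rw [lintegral_add_right _ measurable_const]; simp [mul_comm]
    _ ≤ _ := by gcongr; exact setLIntegral_cube_le _ hℓ hx

/-- Marcinkiewicz interpolation: at level `s`, only the part of `g` above `s / 2` matters, and the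
weak type bound applies to it. The factor `q / (q - 1)` is kept explicit because it becomes `p' *
r'`. -/
theorem lintegral_hlMaximal_rpow_le {q : ℝ} (hq : 1 < q) {g : EuclideanSpace ℝ (Fin n) → ℝ≥0∞}
    (hg : AEMeasurable g) :
    ∫⁻ x, hlMaximal g x ^ q ≤ 5 ^ n * 2 ^ q * ENNReal.ofReal (q / (q - 1)) * ∫⁻ x, g x ^ q := by
  wlog hgm : Measurable g generalizing g
  · have h := this hg.measurable_mk.aemeasurable hg.measurable_mk
    rw [← hlMaximal_congr_ae hg.ae_eq_mk] at h
    refine h.trans_eq ?_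
    congr 1
    exact lintegral_congr_ae (hg.ae_eq_mk.mono fun x hx => by simp only [hx])
  have hq0 : 0 < q := by linarith
  have hq1 : 0 < q - 1 := by linarith
  rw [lintegral_rpow_eq_lintegral_measure_lt _ (measurable_hlMaximal g) hq0]
  have hjm : Measurable (Function.uncurry fun (s : ℝ) (x : EuclideanSpace ℝ (Fin n)) =>
      {s : ℝ | ENNReal.ofReal s < 2 * g x}.indicator
        (fun s => ENNReal.ofReal ((q - 1) * s ^ (q - 1 - 1))) s * g x) := by
    exact (measurable_indicator_ofReal_lt measurable_fst
      ((hgm.comp measurable_snd).const_mul 2) (by fun_prop)).mul (hgm.comp measurable_snd)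
  calc _ ≤ ∫⁻ s in Set.Ioi (0 : ℝ), 5 ^ n * ENNReal.ofReal (2 * (q / (q - 1))) *
        ∫⁻ x, {s : ℝ | ENNReal.ofReal s < 2 * g x}.indicator
          (fun s => ENNReal.ofReal ((q - 1) * s ^ (q - 1 - 1))) s * g x := by
        refine setLIntegral_mono (by fun_prop) fun s hs => ?_
        have hs0 : 0 < s := hs
        set t := ENNReal.ofReal (s / 2) with ht
        have ht2 : t + t = ENNReal.ofReal s := by
          rw [ht, ← ENNReal.ofReal_add (by positivity) (by positivity), add_halves]
        have hsub : {x | ENNReal.ofReal s < hlMaximal g x} ⊆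
            {x | t < hlMaximal ({y | t < g y}.indicator g) x} := fun x hx => by
          by_contra H
          have := (hlMaximal_le_indicator_add g t x).trans (add_le_add_left (not_lt.1 H) t)
          rw [ht2] at this
          exact absurd hx (not_lt.2 this)
        have hweak := mul_volume_lt_hlMaximal_le ({y | t < g y}.indicator g) t
        have e1 : ENNReal.ofReal (q * s ^ (q - 1)) = ENNReal.ofReal (2 * (q / (q - 1))) *
            (ENNReal.ofReal ((q - 1) * s ^ (q - 1 - 1)) * t) := by
          rw [ht, ← ENNReal.ofReal_mul (by positivity), ← ENNReal.ofReal_mul (by positivity)]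
          congr 1
          rw [Real.rpow_sub_one hs0.ne' (q - 1)]
          field_simp
        rw [e1]
        calc _ ≤ ENNReal.ofReal (2 * (q / (q - 1))) *
              (ENNReal.ofReal ((q - 1) * s ^ (q - 1 - 1)) *
                (t * volume {x | t < hlMaximal ({y | t < g y}.indicator g) x})) := by
              rw [mul_assoc, mul_assoc]; gcongr
          _ ≤ ENNReal.ofReal (2 * (q / (q - 1))) *
              (ENNReal.ofReal ((q - 1) * s ^ (q - 1 - 1)) *
                (5 ^ n * ∫⁻ y, ‖{y | t < g y}.indicator g y‖ₑ)) := by gcongr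
          _ = _ := by
              rw [mul_left_comm _ (5 ^ n), mul_left_comm _ (5 ^ n), mul_assoc]
              congr 2
              rw [← lintegral_const_mul']
              swap
              · exact ENNReal.ofReal_ne_top
              refine lintegral_congr fun x => ?_
              have : t < g x ↔ ENNReal.ofReal s < 2 * g x := by
                rw [show ENNReal.ofReal s = 2 * t by rw [← ht2, two_mul],
                  ENNReal.mul_lt_mul_iff_right (by simp) (by simp)]
              by_cases h : t < g x
              · simp [h, this.1 h]
              · simp [h, mt this.2 h]
    _ = 5 ^ n * ENNReal.ofReal (2 * (q / (q - 1))) * ∫⁻ x, (2 * g x) ^ (q - 1) * g x := by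
        rw [lintegral_const_mul _ (hjm.lintegral_prod_right),
          lintegral_lintegral_swap hjm.aemeasurable]
        congr 1
        refine lintegral_congr fun x => ?_
        rw [lintegral_mul_const _ ?_, lintegral_indicator_ofReal_lt_mul_rpow hq1]
        exact measurable_indicator_ofReal_lt measurable_id measurable_const (by fun_prop)
    _ = 5 ^ n * ENNReal.ofReal (2 * (q / (q - 1))) * (2 ^ (q - 1) * ∫⁻ x, g x ^ q) := by
        rw [← lintegral_const_mul (2 ^ (q - 1)) (by fun_prop)]
        congr 1
        refine lintegral_congr fun x => ?_
        rw [ENNReal.mul_rpow_of_nonneg _ _ hq1.le, mul_assoc]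
        congr 1
        nth_rw 2 [← ENNReal.rpow_one (g x)]
        rw [← ENNReal.rpow_add_of_nonneg _ _ hq1.le zero_le_one, sub_add_cancel]
    _ = _ := by
        rw [ENNReal.ofReal_mul (by norm_num)]
        have : (2 : ℝ≥0∞) ^ q = 2 * 2 ^ (q - 1) := by
          nth_rw 2 [← ENNReal.rpow_one 2]
          rw [← ENNReal.rpow_add_of_nonneg _ _ zero_le_one hq1.le, add_sub_cancel]
        rw [this, ENNReal.ofReal_ofNat]
        ring

theorem hlMaximal_le_indicator_add_indicator_compl (g : EuclideanSpace ℝ (Fin n) → ℝ≥0∞)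
    {s : Set (EuclideanSpace ℝ (Fin n))} (hs : MeasurableSet s) (x : EuclideanSpace ℝ (Fin n)) :
    hlMaximal g x ≤ hlMaximal (s.indicator g) x + hlMaximal (sᶜ.indicator g) x := by
  refine hlMaximal_le g fun a ℓ hℓ hx => ?_
  rw [mul_add]
  refine le_trans ?_ (add_le_add (setLIntegral_cube_le _ hℓ hx) (setLIntegral_cube_le _ hℓ hx))
  simp only [enorm_eq_self]
  rw [lintegral_indicator hs, lintegral_indicator hs.compl, lintegral_add_compl _ hs]

theorem cube_subset_triple (a : EuclideanSpace ℝ (Fin n)) (ℓ : ℝ) :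
    cube a ℓ ⊆ cube (WithLp.toLp 2 fun i => a i - ℓ) (3 * ℓ) := fun y hy i => by
  have := hy i
  simp only [Set.mem_Ioo] at this ⊢
  constructor <;> linarith

theorem volume_cube_triple (a b : EuclideanSpace ℝ (Fin n)) (ℓ : ℝ) :
    volume (cube b (3 * ℓ)) = 3 ^ n * volume (cube a ℓ) := by
  rw [volume_cube, volume_cube, ENNReal.ofReal_mul (by norm_num), mul_pow]
  norm_num

/-- A cube through `y` that leaves the tripled cube has side larger than `ℓ`, so its own triple
contains `x`. The far part of `g` thus has an almost constant maximal function on the cube. -/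
theorem hlMaximal_compl_triple_le (g : EuclideanSpace ℝ (Fin n) → ℝ≥0∞)
    {a x y : EuclideanSpace ℝ (Fin n)} {ℓ : ℝ} (hx : x ∈ cube a ℓ)
    (hy : y ∈ cube a ℓ) :
    hlMaximal ((cube (WithLp.toLp 2 fun i => a i - ℓ) (3 * ℓ))ᶜ.indicator g) y ≤
      3 ^ n * hlMaximal g x := by
  refine hlMaximal_le _ fun b m hm hyb => ?_
  simp only [enorm_eq_self]
  rw [lintegral_indicator (isOpen_cube _ _).measurableSet.compl,
    Measure.restrict_restrict (isOpen_cube _ _).measurableSet.compl]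
  rcases Set.eq_empty_or_nonempty ((cube (WithLp.toLp 2 fun i => a i - ℓ) (3 * ℓ))ᶜ ∩ cube b m)
    with h | ⟨z, hz, hzb⟩
  · simp [h]
  have hlm : ℓ < m := by
    by_contra! H
    refine hz fun i => ?_
    have h1 := hy i
    have h2 := hyb i
    have h3 := hzb i
    simp only [Set.mem_Ioo] at h1 h2 h3 ⊢
    constructor <;> linarith
  have hx' : x ∈ cube (WithLp.toLp 2 fun i => b i - m) (3 * m) := fun i => by
    have h1 := hy i
    have h2 := hyb i
    have h3 := hx i
    simp only [Set.mem_Ioo] at h1 h2 h3 ⊢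
    constructor <;> linarith
  calc _ ≤ ∫⁻ y in cube (WithLp.toLp 2 fun i => b i - m) (3 * m), g y :=
        lintegral_mono_set (Set.inter_subset_right.trans (cube_subset_triple b m))
    _ ≤ _ := by
        have := setLIntegral_cube_le g (by positivity) hx'
        rw [volume_cube_triple b] at this
        simp only [enorm_eq_self] at this
        rw [← mul_assoc, mul_comm _ (3 ^ n)]
        exact this

theorem hlMaximal_indicator_eq_zero (g : EuclideanSpace ℝ (Fin n) → ℝ≥0∞)
    {s : Set (EuclideanSpace ℝ (Fin n))} (hs : MeasurableSet s) (h : ∫⁻ y in s, g y = 0)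
    (x : EuclideanSpace ℝ (Fin n)) : hlMaximal (s.indicator g) x = 0 := by
  refine le_antisymm (hlMaximal_le _ fun a ℓ _ _ => ?_) zero_le
  simp only [enorm_eq_self, mul_zero]
  rw [← h, ← lintegral_indicator hs]
  exact setLIntegral_le_lintegral _ _

/-- The Coifman–Rochberg estimate. -/
theorem hlMaximal_hlMaximal_rpow_le (g : EuclideanSpace ℝ (Fin n) → ℝ≥0∞) {δ : ℝ} (h0 : 0 < δ)
    (h1 : δ < 1) (x : EuclideanSpace ℝ (Fin n)) :
    hlMaximal (fun y => hlMaximal g y ^ δ) x ≤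
      ENNReal.ofReal (2 * 15 ^ n / (1 - δ)) * hlMaximal g x ^ δ := by
  have h1' : 0 < 1 - δ := by linarith
  rcases eq_or_ne (hlMaximal g x) ∞ with ht | ht
  · rw [ht, ENNReal.top_rpow_of_pos h0, ENNReal.mul_top]
    · exact le_top
    · simp only [ne_eq, ENNReal.ofReal_eq_zero, not_le]; positivity
  refine hlMaximal_le _ fun a ℓ hℓ hx => ?_
  set S := cube (WithLp.toLp 2 fun i => a i - ℓ) (3 * ℓ) with hS
  have hSm : MeasurableSet S := (isOpen_cube _ _).measurableSet
  have hint : ∫⁻ y in S, g y ≤ volume (cube a ℓ) * (3 ^ n * hlMaximal g x) := by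
    have := setLIntegral_cube_le g (a := WithLp.toLp 2 fun i => a i - ℓ) (ℓ := 3 * ℓ)
      (by positivity) (cube_subset_triple a ℓ hx)
    rw [volume_cube_triple a] at this
    simp only [enorm_eq_self] at this
    rwa [← mul_assoc, mul_comm _ (3 ^ n)]
  have near : ∫⁻ y in cube a ℓ, hlMaximal (S.indicator g) y ^ δ ≤
      volume (cube a ℓ) * (ENNReal.ofReal (15 ^ n / (1 - δ)) * hlMaximal g x ^ δ) := by
    -- Kolmogorov's inequality needs `T > 0`, so vanishing `Mg(x)` is treated apart. Below, `T = 15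
    -- ^ n * Mg(x)`: `5 ^ n` from the weak type bound, `3 ^ n` from the tripled cube.
    rcases eq_or_ne (hlMaximal g x) 0 with hz | hz
    · have : ∫⁻ y in S, g y = 0 := by simpa [hz] using hint
      simp [hlMaximal_indicator_eq_zero g hSm this, h0]
    have hpos : 0 < (hlMaximal g x).toReal := ENNReal.toReal_pos hz ht
    have := lintegral_rpow_le_of_weak_type (volume.restrict (cube a ℓ))
      (measurable_hlMaximal (S.indicator g)) h0 h1 (T := 15 ^ n * (hlMaximal g x).toReal)
      (by positivity) fun s hs => ?_
    · refine this.trans ?_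
      rw [Measure.restrict_apply_univ]
      gcongr
      rw [← ENNReal.ofReal_toReal ht, ENNReal.ofReal_rpow_of_pos (by simpa using hpos),
        ← ENNReal.ofReal_mul (by positivity)]
      simp only [ENNReal.ofReal_toReal ht]
      apply ENNReal.ofReal_le_ofReal
      rw [Real.mul_rpow (by positivity) hpos.le, div_mul_eq_mul_div]
      gcongr
      exact Real.rpow_le_self_of_one_le (one_le_pow₀ (by norm_num)) h1.le
    · calc _ ≤ ENNReal.ofReal s * volume {x | ENNReal.ofReal s < hlMaximal (S.indicator g) x} := by
            gcongr; exact Measure.restrict_le_self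
        _ ≤ 5 ^ n * ∫⁻ y, ‖S.indicator g y‖ₑ := mul_volume_lt_hlMaximal_le _ _
        _ = 5 ^ n * ∫⁻ y in S, g y := by simp only [enorm_eq_self]; rw [lintegral_indicator hSm]
        _ ≤ 5 ^ n * (volume (cube a ℓ) * (3 ^ n * hlMaximal g x)) := by gcongr
        _ = _ := by
            rw [Measure.restrict_apply_univ, ENNReal.ofReal_mul (by positivity),
              ENNReal.ofReal_toReal ht, ENNReal.ofReal_pow (by norm_num), ENNReal.ofReal_ofNat,
              show (15 : ℝ≥0∞) = 5 * 3 by norm_num, mul_pow]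
            ring
  simp only [enorm_eq_self]
  calc ∫⁻ y in cube a ℓ, hlMaximal g y ^ δ
      ≤ ∫⁻ y in cube a ℓ, (hlMaximal (S.indicator g) y ^ δ +
          ENNReal.ofReal (15 ^ n / (1 - δ)) * hlMaximal g x ^ δ) := by
        refine setLIntegral_mono (((measurable_hlMaximal _).pow_const _).add_const _) fun y hy => ?_
        calc hlMaximal g y ^ δ ≤ (hlMaximal (S.indicator g) y + 3 ^ n * hlMaximal g x) ^ δ := by
              gcongr
              exact (hlMaximal_le_indicator_add_indicator_compl g hSm y).trans
                (by gcongr; exact hlMaximal_compl_triple_le g hx hy)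
          _ ≤ hlMaximal (S.indicator g) y ^ δ + (3 ^ n * hlMaximal g x) ^ δ :=
              ENNReal.rpow_add_le_add_rpow _ _ h0.le h1.le
          _ ≤ _ := by
              rw [ENNReal.mul_rpow_of_nonneg _ _ h0.le]
              gcongr
              calc ((3 : ℝ≥0∞) ^ n) ^ δ ≤ 3 ^ n :=
                    (ENNReal.rpow_le_rpow_of_exponent_le (one_le_pow₀ (by norm_num)) h1.le).trans
                      (ENNReal.rpow_one _).le
                _ = ENNReal.ofReal (3 ^ n) := by
                    rw [ENNReal.ofReal_pow (by norm_num), ENNReal.ofReal_ofNat]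
                _ ≤ _ := by
                    apply ENNReal.ofReal_le_ofReal
                    calc (3 : ℝ) ^ n ≤ 15 ^ n := by gcongr; norm_num
                      _ ≤ _ := by
                        rw [le_div_iff₀ h1']
                        exact mul_le_of_le_one_right (by positivity) (by linarith)
    _ = (∫⁻ y in cube a ℓ, hlMaximal (S.indicator g) y ^ δ) +
          volume (cube a ℓ) * (ENNReal.ofReal (15 ^ n / (1 - δ)) * hlMaximal g x ^ δ) := by
        rw [lintegral_add_right _ measurable_const]; simp [mul_comm]
    _ ≤ _ := by
        refine (add_le_add_left near _).trans_eq ?_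
        rw [show 2 * 15 ^ n / (1 - δ) = 2 * (15 ^ n / (1 - δ)) by ring,
          ENNReal.ofReal_mul (by norm_num), ENNReal.ofReal_ofNat]
        ring
end

/-! ### The two-weight inequality for `M` and its iteration. -/

section
variable {n : ℕ}

theorem measurable_hlMaximalPow {ε : Type*} [ENorm ε] (r : ℝ) (g : EuclideanSpace ℝ (Fin n) → ε) :
    Measurable (hlMaximalPow r g) :=
  (measurable_hlMaximal _).pow_const _

theorem le_mul_rpow_neg_mul_rpow {g w : ℝ≥0∞} {b : ℝ} (h0 : w = 0 → g = 0)
    (ht : w ≠ ∞) : g ≤ g * w ^ (-b) * w ^ b := by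
  rcases eq_or_ne w 0 with hw | hw
  · simp [h0 hw]
  · rw [mul_assoc, ← ENNReal.rpow_add _ _ hw ht, neg_add_cancel, ENNReal.rpow_zero, mul_one]

/-- The pointwise bound behind the two-weight inequality, obtained from Hölder's inequality with
exponents `a` and `a'`. -/
theorem hlMaximal_le_mul_hlMaximalPow {g w : EuclideanSpace ℝ (Fin n) → ℝ≥0∞}
    (hg : AEMeasurable g) (hw : AEMeasurable w) (h0 : ∀ᵐ y, w y = 0 → g y = 0)
    {b r a a' : ℝ} (hb : 0 < b) (hr : 0 < r) (ha : a'.HolderConjugate a) (hab : b * a = r)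
    {x : EuclideanSpace ℝ (Fin n)} (hx : hlMaximalPow r w x ≠ ∞) :
    hlMaximal g x ≤ hlMaximal (fun y => (g y * w y ^ (-b)) ^ a') x ^ (1 / a') *
      hlMaximalPow r w x ^ b := by
  have hMx : hlMaximal (fun y => w y ^ r) x ≠ ∞ := fun h => by
    apply hx
    simp only [hlMaximalPow, enorm_eq_self, h]
    exact ENNReal.top_rpow_of_pos (by positivity)
  have ha0 : 0 < a := ha.symm.pos
  have ha'0 : 0 < a' := ha.pos
  unfold hlMaximal
  refine iSup_le fun z => iSup_le fun ℓ => iSup_le fun hℓ => iSup_le fun hxz => ?_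
  have hfin : ∀ᵐ y ∂volume.restrict (cube z ℓ), w y ≠ ∞ := by
    have h1 : ∫⁻ y in cube z ℓ, w y ^ r ≠ ∞ := by
      have := setLIntegral_cube_le (fun y => w y ^ r) hℓ hxz
      simp only [enorm_eq_self] at this
      exact ne_top_of_le_ne_top (ENNReal.mul_ne_top (volume_cube_ne_top _ _) hMx) this
    filter_upwards [ae_lt_top' (hw.restrict.pow_const r) h1] with y hy h
    simp [h, hr] at hy
  -- Normalising the measure on the cube turns Hölder's inequality into one between averages.
  set μ : Measure (EuclideanSpace ℝ (Fin n)) :=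
    (volume (cube z ℓ))⁻¹ • volume.restrict (cube z ℓ) with hμ
  have hi (φ : EuclideanSpace ℝ (Fin n) → ℝ≥0∞) :
      ∫⁻ y, φ y ∂μ = (volume (cube z ℓ))⁻¹ * ∫⁻ y in cube z ℓ, φ y := by
    rw [hμ, lintegral_smul_measure, smul_eq_mul]
  have hac : μ ≪ volume :=
    (Measure.smul_absolutelyContinuous).trans Measure.restrict_le_self.absolutelyContinuous
  have hgm := hg.mono_ac hac
  have hwm := hw.mono_ac hac
  calc _ = ∫⁻ y, g y ∂μ := by simp [hi]
    _ ≤ ∫⁻ y, ((fun y => g y * w y ^ (-b)) * fun y => w y ^ b) y ∂μ := by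
        refine lintegral_mono_ae ?_
        filter_upwards [hac.ae_le h0,
          (Measure.smul_absolutelyContinuous (c := (volume (cube z ℓ))⁻¹)).ae_le hfin] with y h1 h2
        exact le_mul_rpow_neg_mul_rpow h1 h2
    _ ≤ (∫⁻ y, (g y * w y ^ (-b)) ^ a' ∂μ) ^ (1 / a') * (∫⁻ y, (w y ^ b) ^ a ∂μ) ^ (1 / a) :=
        ENNReal.lintegral_mul_le_Lp_mul_Lq μ ha (hgm.mul (hwm.pow_const _)) (hwm.pow_const _)
    _ ≤ _ := by
        simp only [← ENNReal.rpow_mul, hab]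
        gcongr ?_ ^ _ * ?_
        · rw [hi]
          exact le_hlMaximal (fun y => (g y * w y ^ (-b)) ^ a') hℓ hxz
        · rw [hlMaximalPow, ← ENNReal.rpow_mul, show 1 / r * b = 1 / a by rw [← hab]; field_simp, hi]
          gcongr
          exact le_hlMaximal (fun y => w y ^ r) hℓ hxz

/-- The maximal function maps `L^p(w^{1-p})` into `L^p((M_r w)^{1-p})`. -/
theorem lintegral_hlMaximal_rpow_mul_hlMaximalPow_le {p r : ℝ} (hp : 1 < p) (hr : 1 < r)
    {g w : EuclideanSpace ℝ (Fin n) → ℝ≥0∞} (hg : AEMeasurable g) (hw : AEMeasurable w) :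
    ∫⁻ x, hlMaximal g x ^ p * hlMaximalPow r w x ^ (1 - p) ≤
      5 ^ n * 2 ^ p * ENNReal.ofReal (p.conjExponent * r.conjExponent) *
        ∫⁻ x, g x ^ p * w x ^ (1 - p) := by
  have hp0 : 0 < p := by linarith
  have hp1 : 0 < p - 1 := by linarith
  have hr0 : 0 < r := by linarith
  have hr1 : 0 < r - 1 := by linarith
  rcases eq_or_ne (∫⁻ x, g x ^ p * w x ^ (1 - p)) ∞ with htop | htop
  · rw [htop, ENNReal.mul_top]
    · exact le_top
    · have : 0 < p.conjExponent * r.conjExponent := by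
        unfold Real.conjExponent; positivity
      simp [this]
  -- Since `0 ^ (1 - p) = ∞`, a finite right side forces `g` to vanish where `w` does.
  have h0 : ∀ᵐ y, w y = 0 → g y = 0 := by
    filter_upwards [ae_lt_top' ((hg.pow_const p).mul (hw.pow_const (1 - p))) htop] with y hy hwy
    by_contra hgy
    rw [Pi.mul_apply, hwy, ENNReal.zero_rpow_of_neg (by linarith), ENNReal.mul_top] at hy
    · exact lt_irrefl _ hy
    · simp [hgy, hp0.not_gt]
  -- `b = 1 / p'`, so `b * p = p - 1` cancels the weight; `a` is fixed by `b * a = r`, and `q` by `1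
  -- / a + q / p = 1`.
  set b := (p - 1) / p with hb
  set a := p * r / (p - 1) with ha
  set q := p - (p - 1) / r with hq
  set a' := p / q with ha'
  have hqp : q ≤ p := by have : 0 < (p - 1) / r := by positivity
                         linarith
  have hq1 : q - 1 = (p - 1) * (r - 1) / r := by rw [hq]; field_simp; ring
  have hq1' : 0 < q - 1 := by rw [hq1]; positivity
  have hq0 : 0 < q := by linarith
  have hconj : a'.HolderConjugate a := by
    refine Real.holderConjugate_iff.2 ⟨?_, ?_⟩
    · rw [ha', lt_div_iff₀ hq0, one_mul, hq]
      have : 0 < (p - 1) / r := by positivity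
      linarith
    · rw [ha', ha, hq]; field_simp; ring
  have hG : AEMeasurable fun y => (g y * w y ^ (-b)) ^ a' :=
    (hg.mul (hw.pow_const _)).pow_const _
  calc _ ≤ ∫⁻ x, hlMaximal (fun y => (g y * w y ^ (-b)) ^ a') x ^ q := by
        refine lintegral_mono fun x => ?_
        set V := hlMaximalPow r w x with hV
        -- Where `V = ∞` the weight is zero; where `V = 0` the Hölder bound forces `Mg = 0`.
        -- Elsewhere the powers of `V` cancel.
        rcases eq_or_ne V ∞ with hVt | hVt
        · simp [hVt, ENNReal.top_rpow_of_neg (show 1 - p < 0 by linarith)]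
        have := hlMaximal_le_mul_hlMaximalPow hg hw h0 (by positivity) hr0 hconj
          (show b * a = r by rw [hb, ha]; field_simp) hVt
        rw [← hV] at this
        have := ENNReal.rpow_le_rpow this hp0.le
        rw [ENNReal.mul_rpow_of_nonneg _ _ hp0.le, ← ENNReal.rpow_mul, ← ENNReal.rpow_mul,
          show 1 / a' * p = q by rw [ha']; field_simp,
          show b * p = p - 1 by rw [hb]; field_simp] at this
        rcases eq_or_ne V 0 with hV0 | hV0
        · rw [hV0, ENNReal.zero_rpow_of_pos hp1, mul_zero, nonpos_iff_eq_zero] at this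
          simp [this]
        · calc _ ≤ _ := mul_le_mul_left this _
            _ = _ := by
              rw [mul_assoc, ← ENNReal.rpow_add _ _ hV0 hVt, show p - 1 + (1 - p) = 0 by ring,
                ENNReal.rpow_zero, mul_one]
    _ ≤ 5 ^ n * 2 ^ q * ENNReal.ofReal (q / (q - 1)) *
        ∫⁻ x, ((g x * w x ^ (-b)) ^ a') ^ q := lintegral_hlMaximal_rpow_le (by linarith) hG
    _ = 5 ^ n * 2 ^ q * ENNReal.ofReal (q / (q - 1)) * ∫⁻ x, g x ^ p * w x ^ (1 - p) := by
        congr 1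
        refine lintegral_congr fun x => ?_
        rw [← ENNReal.rpow_mul, show a' * q = p by rw [ha']; field_simp,
          ENNReal.mul_rpow_of_nonneg _ _ hp0.le, ← ENNReal.rpow_mul,
          show -b * p = 1 - p by rw [hb]; field_simp; ring]
    _ ≤ _ := by
        gcongr
        · norm_num
        · rw [hq1]
          calc q / ((p - 1) * (r - 1) / r) ≤ p / ((p - 1) * (r - 1) / r) := by gcongr
            _ = _ := by unfold Real.conjExponent; field_simp

/-- `M_r w` is an `A₁` weight, with a reverse Hölder exponent `(1 + r) / 2`. -/
theorem hlMaximalPow_hlMaximalPow_le {r : ℝ} (hr : 1 < r) (w : EuclideanSpace ℝ (Fin n) → ℝ≥0∞)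
    (x : EuclideanSpace ℝ (Fin n)) :
    hlMaximalPow ((1 + r) / 2) (hlMaximalPow r w) x ≤
      ENNReal.ofReal (4 * 15 ^ n * r.conjExponent) * hlMaximalPow r w x := by
  -- At the midpoint `1 - s / r = 1 / (2 * r')`, so Coifman–Rochberg costs one factor `r'`, while
  -- `s'` stays at most `2 * r'`.
  set s := (1 + r) / 2 with hs
  have hs1 : 1 < s := by linarith
  have hs0 : 0 < s := by linarith
  have hr0 : 0 < r := by linarith
  have hr1 : 0 < r - 1 := by linarith
  have h := hlMaximal_hlMaximal_rpow_le (fun y => w y ^ r) (δ := s / r) (by positivity)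
    (by rw [div_lt_one hr0]; linarith) x
  have hK : 2 * 15 ^ n / (1 - s / r) = 4 * 15 ^ n * r.conjExponent := by
    unfold Real.conjExponent
    rw [show 1 - s / r = (r - 1) / (2 * r) by rw [hs]; field_simp; ring]
    field_simp; ring
  rw [hK] at h
  have hK1 : 1 ≤ 4 * 15 ^ n * r.conjExponent := by
    have h1 : (1 : ℝ) ≤ 15 ^ n := one_le_pow₀ (by norm_num)
    have h2 : 1 ≤ r.conjExponent := by
      unfold Real.conjExponent; rw [le_div_iff₀ hr1]; linarith
    nlinarith
  simp only [hlMaximalPow, enorm_eq_self, ← ENNReal.rpow_mul]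
  rw [show 1 / r * s = s / r by ring]
  calc _ ≤ (ENNReal.ofReal (4 * 15 ^ n * r.conjExponent) *
        hlMaximal (fun y => w y ^ r) x ^ (s / r)) ^ (1 / s) := by gcongr
    _ ≤ _ := by
      rw [ENNReal.mul_rpow_of_nonneg _ _ (by positivity), ← ENNReal.rpow_mul,
        show s / r * (1 / s) = 1 / r by field_simp]
      gcongr
      calc _ ≤ _ := ENNReal.rpow_le_rpow_of_exponent_le (ENNReal.one_le_ofReal.2 hK1)
            (show 1 / s ≤ 1 by rw [div_le_one hs0]; linarith)
        _ = _ := ENNReal.rpow_one _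

theorem rpow_neg_le_of_le_mul {u v K : ℝ≥0∞} (hK0 : K ≠ 0) (hK : K ≠ ∞) (h : u ≤ K * v) {t : ℝ}
    (ht : 0 ≤ t) : v ^ (-t) ≤ K ^ t * u ^ (-t) := by
  have h1 : (K * v) ^ (-t) ≤ u ^ (-t) := by
    rw [ENNReal.rpow_neg, ENNReal.rpow_neg]
    gcongr
  rw [ENNReal.mul_rpow_eq_ite, if_neg (by simp [hK0, hK])] at h1
  calc v ^ (-t) = K ^ t * (K ^ (-t) * v ^ (-t)) := by
        rw [← mul_assoc, ← ENNReal.rpow_add _ _ hK0 hK, add_neg_cancel, ENNReal.rpow_zero, one_mul]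
    _ ≤ _ := by gcongr

theorem lintegral_hlMaximal_hlMaximal_rpow_mul_le {p r : ℝ} (hp : 1 < p) (hr : 1 < r)
    {g w : EuclideanSpace ℝ (Fin n) → ℝ≥0∞} (hg : AEMeasurable g) (hw : AEMeasurable w) :
    ∫⁻ x, hlMaximal (hlMaximal g) x ^ p * hlMaximalPow r w x ^ (1 - p) ≤
      ENNReal.ofReal ((32 * 25 ^ n * 15 ^ n * p.conjExponent ^ 2 *
        r.conjExponent ^ (1 + 1 / p)) ^ p) * ∫⁻ x, g x ^ p * w x ^ (1 - p) := by
  have hp0 : 0 < p := by linarith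
  have hp1 : 0 < p - 1 := by linarith
  have hr0 : 0 < r := by linarith
  have hr1 : 0 < r - 1 := by linarith
  have hP : 1 ≤ p.conjExponent := by
    unfold Real.conjExponent; rw [le_div_iff₀ hp1]; linarith
  have hR : 1 ≤ r.conjExponent := by
    unfold Real.conjExponent; rw [le_div_iff₀ hr1]; linarith
  set P := p.conjExponent
  set R := r.conjExponent with hRdef
  set s := (1 + r) / 2 with hs
  have hsR : s.conjExponent ≤ 2 * R := by
    rw [hRdef]; unfold Real.conjExponent
    rw [show s - 1 = (r - 1) / 2 by rw [hs]; ring, hs]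
    rw [show (1 + r) / 2 / ((r - 1) / 2) = (1 + r) / (r - 1) by field_simp,
      show 2 * (r / (r - 1)) = (2 * r) / (r - 1) by ring]
    gcongr; linarith
  set K : ℝ := 4 * 15 ^ n * R with hK
  have hKpos : 0 < K := by positivity
  have h1 := lintegral_hlMaximal_rpow_mul_hlMaximalPow_le hp hr hg hw
  have h2 := lintegral_hlMaximal_rpow_mul_hlMaximalPow_le hp (show 1 < s by linarith)
    (measurable_hlMaximal g).aemeasurable (measurable_hlMaximalPow r w).aemeasurable
  have h3 : ∫⁻ x, hlMaximal (hlMaximal g) x ^ p * hlMaximalPow r w x ^ (1 - p) ≤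
      ENNReal.ofReal K ^ (p - 1) * ∫⁻ x, hlMaximal (hlMaximal g) x ^ p *
        hlMaximalPow s (hlMaximalPow r w) x ^ (1 - p) := by
    rw [← lintegral_const_mul' _ _ (ENNReal.rpow_ne_top_of_nonneg hp1.le ENNReal.ofReal_ne_top)]
    refine lintegral_mono fun x => ?_
    have := rpow_neg_le_of_le_mul (ENNReal.ofReal_pos.2 hKpos).ne' ENNReal.ofReal_ne_top
      (hlMaximalPow_hlMaximalPow_le hr w x) hp1.le
    rw [neg_sub] at this
    rw [mul_left_comm]
    gcongr
  have h5 : (5 : ℝ≥0∞) ^ n * 2 ^ p = ENNReal.ofReal (5 ^ n * 2 ^ p) := by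
    rw [ENNReal.ofReal_mul (by positivity), ENNReal.ofReal_pow (by norm_num),
      ← ENNReal.ofReal_rpow_of_pos (by norm_num)]
    simp
  rw [h5] at h1 h2
  refine h3.trans ?_
  refine (mul_le_mul_right (h2.trans (mul_le_mul_right h1 _)) _).trans ?_
  rw [ENNReal.ofReal_rpow_of_pos hKpos]
  simp only [← mul_assoc]
  have hS0 : 0 ≤ s.conjExponent := by
    unfold Real.conjExponent; exact div_nonneg (by linarith) (by linarith)
  gcongr ?_ * _
  rw [← ENNReal.ofReal_mul (by positivity), ← ENNReal.ofReal_mul (by positivity),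
    ← ENNReal.ofReal_mul (by positivity), ← ENNReal.ofReal_mul (by positivity)]
  apply ENNReal.ofReal_le_ofReal
  have hRp : (R ^ (1 + 1 / p)) ^ p = R ^ (p - 1) * R ^ 2 := by
    rw [← Real.rpow_mul (by positivity), ← Real.rpow_natCast R 2, ← Real.rpow_add (by positivity)]
    congr 1; field_simp; push_cast; ring
  -- Factors that are at least `1` are enlarged to their `p`-th powers, so that the final root
  -- leaves a constant depending on `n` only.
  have self_le {y : ℝ} (hy : 1 ≤ y) : y ≤ y ^ p := Real.self_le_rpow_of_one_le hy hp.le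
  have hA : (4 * 15 ^ n : ℝ) ^ (p - 1) ≤ (4 * 15 ^ n) ^ p := by
    have : (1 : ℝ) ≤ 15 ^ n := one_le_pow₀ (by norm_num)
    exact Real.rpow_le_rpow_of_exponent_le (by linarith) (by linarith)
  calc K ^ (p - 1) * (5 ^ n * 2 ^ p) * (P * s.conjExponent) * (5 ^ n * 2 ^ p) * (P * R)
      ≤ K ^ (p - 1) * (5 ^ n * 2 ^ p) * (P * (2 * R)) * (5 ^ n * 2 ^ p) * (P * R) := by gcongr
    _ = (4 * 15 ^ n) ^ (p - 1) * (2 ^ p * 2 ^ p) * (2 * 25 ^ n) * P ^ 2 *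
        (R ^ (p - 1) * R ^ 2) := by
        rw [hK, Real.mul_rpow (by positivity) (by positivity),
          show (25 : ℝ) = 5 * 5 by norm_num, mul_pow]
        ring
    _ ≤ (4 * 15 ^ n) ^ p * (2 ^ p * 2 ^ p) * (2 * 25 ^ n) ^ p * (P ^ 2) ^ p *
        (R ^ (p - 1) * R ^ 2) := by
        gcongr
        · apply self_le
          have : (1 : ℝ) ≤ 25 ^ n := one_le_pow₀ (by norm_num)
          linarith
        · exact self_le (one_le_pow₀ hP)
    _ ≤ _ := by
        rw [← hRp]
        rw [← Real.mul_rpow (by positivity) (by positivity),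
          ← Real.mul_rpow (by positivity) (by positivity),
          ← Real.mul_rpow (by positivity) (by positivity),
          ← Real.mul_rpow (by positivity) (by positivity),
          ← Real.mul_rpow (by positivity) (by positivity)]
        refine Real.rpow_le_rpow (by positivity) (le_of_eq ?_) hp0.le
        ring

theorem weightedLpNorm_rpow {ε : Type*} [TopologicalSpace ε] [ContinuousENorm ε] {p : ℝ}
    (hp : 0 < p)
    {v : EuclideanSpace ℝ (Fin n) → ℝ≥0∞} (hv : AEMeasurable v)
    {g : EuclideanSpace ℝ (Fin n) → ε} (hg : AEMeasurable fun x => ‖g x‖ₑ) :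
    weightedLpNorm p v g = (∫⁻ x, ‖g x‖ₑ ^ p * v x) ^ (1 / p) := by
  unfold weightedLpNorm
  rw [eLpNorm_eq_lintegral_rpow_enorm_toReal (by simpa using hp) ENNReal.ofReal_ne_top,
    ENNReal.toReal_ofReal hp.le, lintegral_withDensity_eq_lintegral_mul₀ hv (hg.pow_const p)]
  simp [mul_comm]

end

theorem proposition3p2 (n : ℕ) :
    ∃ c : ℝ, 0 < c ∧
      ∀ p r : ℝ, 1 < p → 1 < r →
      ∀ w : EuclideanSpace ℝ (Fin n) → ℝ≥0, AEMeasurable w volume →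
      ∀ f : EuclideanSpace ℝ (Fin n) → ℂ, AEStronglyMeasurable f volume →
        Measurable (hlMaximal (hlMaximal f)) ∧
        weightedLpNorm p (fun x => hlMaximalPow r w x ^ (1 - p)) (hlMaximal (hlMaximal f)) ≤
          ENNReal.ofReal (c * p.conjExponent ^ 2 * r.conjExponent ^ (1 + 1 / p)) *
            weightedLpNorm p (fun x => (w x : ℝ≥0∞) ^ (1 - p)) f := by
  refine ⟨32 * 25 ^ n * 15 ^ n, by positivity, fun p r hp hr w hw f hf =>
    ⟨measurable_hlMaximal _, ?_⟩⟩
  have hp0 : 0 < p := by linarith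
  -- The extended norm of a nonnegative real is definitionally its coercion.
  have hpow : hlMaximalPow r w = hlMaximalPow r fun x => (w x : ℝ≥0∞) := rfl
  have hwm : AEMeasurable fun x => (w x : ℝ≥0∞) := hw.coe_nnreal_ennreal
  rw [weightedLpNorm_rpow hp0 ((measurable_hlMaximalPow r w).pow_const _).aemeasurable
      (measurable_hlMaximal _).aemeasurable,
    weightedLpNorm_rpow hp0 (hwm.pow_const _) hf.enorm, hpow, ← hlMaximal_enorm f]
  simp only [enorm_eq_self]
  have hc : 0 ≤ 32 * 25 ^ n * 15 ^ n * p.conjExponent ^ 2 * r.conjExponent ^ (1 + 1 / p) := by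
    have : 0 ≤ r.conjExponent := div_nonneg (by linarith) (by linarith)
    positivity
  refine (ENNReal.rpow_le_rpow (lintegral_hlMaximal_hlMaximal_rpow_mul_le hp hr hf.enorm hwm)
    (by positivity)).trans_eq ?_
  rw [ENNReal.mul_rpow_of_nonneg _ _ (by positivity), ← ENNReal.ofReal_rpow_of_nonneg hc hp0.le,
    ← ENNReal.rpow_mul, mul_one_div_cancel hp0.ne', ENNReal.rpow_one]
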